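/- Let $\Lambda\subset\mathbb{R}$ be compact and infinite, and let $G$ be a simple graph on a countably infinite vertex set (not necessarily locally finite). A real symmetric matrix $A$ indexed by the vertices of a graph has that graph if, for $i\neq j$, $A_{ij}\neq 0$ exactly when $i$ and $j$ are adjacent. A real symmetric $n\times n$ matrix $A$ has the Weak Spectral Property if $X=0$ is the only real symmetric matrix with zero diagonal that satisfies $XA=AX$. Write $\|\cdot\|$ for the operator norm (with respect to the Euclidean norm, respectively the $\ell^2$-norm). A bounded operator $T$ on $\ell^2(\mathbb{N})$ (with real or complex scalars) is said to be obtained by the construction with data $(G,\Lambda)$ if there are a labelling of the vertices of $G$ by $1,2,3,\dots$, a sequence $\lambda_1,\lambda_2,\dots$ of distinct elements of $\Lambda$ such that $\{\lambda_1,\lambda_2,\dots\}$ is dense in $\Lambda$, and real symmetric $n\times n$ matrices $A_n$ ($n\ge 1$) such that 1. for every $n\ge1$ the graph of $A_n$ is the subgraph of $G$ induced on the vertices $1,\dots,n$, the spectrum of $A_n$ is $\{\lambda_1,\dots,\lambda_n\}$, and $A_n$ has the Weak Spectral Property; 2. for every $n\ge1$, $A_{n+1}$ differs from $A_n\oplus[\lambda_{n+1}]$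 only on the diagonal and in the last row and column, and $\big\|A_n\oplus[\lambda_{n+1}]-A_{n+1}\big\|<2^{-n}$; 3. $T=\lim_{n\to\infty}T_n$ in operator norm, where $T_n$ is the bounded operator on $\ell^2(\mathbb{N})$ whose standard matrix is $A_n\oplus\operatorname{diag}(\lambda_{n+1},\lambda_{n+2},\dots)$. Bounded operators $T_1,T_2$ on Hilbert spaces $H_1,H_2$ are approximately unitarily equivalent, written $T_1\sim_a T_2$, if there are unitary isomorphisms $U_n\colon H_1\to H_2$ with $\|T_1-U_n^*T_2U_n\|\to0$. **Corollary.** Let $G_1,G_2$ be graphs on countably infinite vertex sets and let $\Lambda\subset\mathbb{R}$ be compact and infinite. If $S$ and $T$ are obtained by the construction with data $(G_1,\Lambda)$ and $(G_2,\Lambda)$, respectively (both over the same scalars, $\mathbb{R}$ or $\mathbb{C}$), then $S\sim_a T$. In particular, for every sequence $\mu_1,\mu_2,\dots$ of distinct elements of $\Lambda$ whose set of values is dense in $\Lambda$, $T\sim_a\operatorname{diag}(\mu_1,\mu_2,\dots)$. -/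

import Mathlib

open Filter Topology

/-- The Hilbert space `ℓ²(ℕ)` of square-summable sequences with scalars in `𝕜`
(which is `ℝ` or `ℂ`). -/
abbrev EllTwo (𝕜 : Type*) [RCLike 𝕜] : Type _ := lp (fun _ : ℕ => 𝕜) 2

/-- The standard matrix of a bounded operator on `ℓ²(ℕ)`: the `j`-th column is the image of the
`j`-th standard basis vector. -/
noncomputable def standardMatrix {𝕜 : Type*} [RCLike 𝕜] (T : EllTwo 𝕜 →L[𝕜] EllTwo 𝕜) :
    Matrix ℕ ℕ 𝕜 :=
  Matrix.of fun i j => T (lp.single 2 j (1 : 𝕜)) i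

/-- Approximate unitary equivalence `T₁ ∼ₐ T₂`: there are unitary isomorphisms `Uₙ : H₁ → H₂` with
`T₁ = lim Uₙ* T₂ Uₙ` in operator norm. The adjoint of a unitary is its inverse `(Uₙ).symm`. -/
def ApproxUnitarilyEquiv {𝕜 H₁ H₂ : Type*} [RCLike 𝕜]
    [NormedAddCommGroup H₁] [InnerProductSpace 𝕜 H₁]
    [NormedAddCommGroup H₂] [InnerProductSpace 𝕜 H₂]
    (T₁ : H₁ →L[𝕜] H₁) (T₂ : H₂ →L[𝕜] H₂) : Prop :=
  ∃ U : ℕ → (H₁ ≃ₗᵢ[𝕜] H₂),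
    Tendsto (fun n => ((U n).symm : H₂ →L[𝕜] H₁) ∘L T₂ ∘L ((U n) : H₁ →L[𝕜] H₂)) atTop (𝓝 T₁)

/-- `G` is the graph of the matrix `A`: off the diagonal, the nonzero entries of `A` are exactly
the edges of `G` (no condition on the diagonal). -/
def IsGraphOf {ι : Type*} (G : SimpleGraph ι) (A : Matrix ι ι ℝ) : Prop :=
  ∀ i j, i ≠ j → (A i j ≠ 0 ↔ G.Adj i j)

/-- The Weak Spectral Property of a symmetric matrix `A`: the only symmetric `X` with zero
diagonal (`X ∘ I = 0`, entrywise product) that commutes with `A` is `X = 0`. -/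
def HasWSP {n : ℕ} (A : Matrix (Fin n) (Fin n) ℝ) : Prop :=
  ∀ X : Matrix (Fin n) (Fin n) ℝ, X.IsSymm → Matrix.hadamard X 1 = 0 → ⁅X, A⁆ = 0 → X = 0

/-- The operator norm of a square real matrix with respect to the Euclidean norm. -/
noncomputable def matrixOpNorm {n : ℕ} (A : Matrix (Fin n) (Fin n) ℝ) : ℝ :=
  ‖Matrix.toEuclideanCLM (n := Fin n) (𝕜 := ℝ) A‖

/-- The block diagonal matrix `A ⊕ [c]`. -/
def appendDiag {n : ℕ} (A : Matrix (Fin n) (Fin n) ℝ) (c : ℝ) :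
    Matrix (Fin (n + 1)) (Fin (n + 1)) ℝ :=
  Matrix.reindex finSumFinEquiv finSumFinEquiv (Matrix.fromBlocks A 0 0 !![c])

/-- The infinite block diagonal matrix `A ⊕ diag(lam n, lam (n + 1), …)`, `A` of size `n`. -/
def extendDiag {n : ℕ} (A : Matrix (Fin n) (Fin n) ℝ) (lam : ℕ → ℝ) : Matrix ℕ ℕ ℝ :=
  Matrix.of fun i j =>
    if h : i < n ∧ j < n then A ⟨i, h.1⟩ ⟨j, h.2⟩ else if i = j then lam i else 0

/-- `lam 0, lam 1, …` is an enumeration, without repetition, of a countable dense subset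
of `Λ`. -/
structure IsDenseEnumeration (Λ : Set ℝ) (lam : ℕ → ℝ) : Prop where
  injective : Function.Injective lam
  mem : ∀ i, lam i ∈ Λ
  dense : Λ ⊆ closure (Set.range lam)

/-- The sequences of finite matrices `A n` (of size `n`) produced by the inductive construction
for a graph `G` with vertices labelled by `ℕ` and distinct reals `lam 0, lam 1, …`.

Each `A n` is a real symmetric matrix with the Weak Spectral Property, its graph is the subgraph of
`G` induced on the first `n` vertices and its spectrum is `{lam 0, …, lam (n - 1)}`.
Passing from `A n ⊕ [lam n]` to `A (n + 1)` alters only the diagonal and the last row and column,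
and is a perturbation of norm less than `1 / 2 ^ n`.
(`A 0` is the empty matrix, so that `A 1` is forced to be `[lam 0]`, the base of the induction.) -/
structure IsConstructedSequence (G : SimpleGraph ℕ) (lam : ℕ → ℝ)
    (A : (n : ℕ) → Matrix (Fin n) (Fin n) ℝ) : Prop where
  symm : ∀ n, (A n).IsSymm
  graph : ∀ n, IsGraphOf (G.comap (fun i : Fin n => (i : ℕ))) (A n)
  spectrum_eq : ∀ n, spectrum ℝ (A n) = lam '' Set.Iio n
  wsp : ∀ n, HasWSP (A n)
  offDiag : ∀ n (i j : Fin n), i ≠ j → A (n + 1) i.castSucc j.castSucc = A n i j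
  close : ∀ n, matrixOpNorm (appendDiag (A n) (lam n) - A (n + 1)) < 1 / 2 ^ n

/-- `T` is an operator on `ℓ²(ℕ)` obtained by the construction for the structured inverse spectrum
problem with data `(G, Λ)`: for some labelling `e` of the vertices of `G` by `ℕ`, some enumeration
`lam` of a countable dense subset of `Λ`, and some sequence `A n` of finite matrices constructed
from these, `T` is the operator norm limit of the bounded operators `Tₙ` with standard matrices
`A n ⊕ diag(lam n, lam (n + 1), …)`. -/
def IsConstructedSolution {𝕜 V : Type*} [RCLike 𝕜] (G : SimpleGraph V) (Λ : Set ℝ)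
    (T : EllTwo 𝕜 →L[𝕜] EllTwo 𝕜) : Prop :=
  ∃ (e : V ≃ ℕ) (lam : ℕ → ℝ) (A : (n : ℕ) → Matrix (Fin n) (Fin n) ℝ)
    (Tₙ : ℕ → (EllTwo 𝕜 →L[𝕜] EllTwo 𝕜)),
    IsDenseEnumeration Λ lam ∧
    IsConstructedSequence (G.comap e.symm) lam A ∧
    (∀ n, standardMatrix (Tₙ n) = (extendDiag (A n) lam).map (fun x : ℝ => (x : 𝕜))) ∧
    Tendsto Tₙ atTop (𝓝 T)

/-! Each `Tₙ` is a finite symmetric block with simple spectrum `lam 0, …, lam (n - 1)` plus a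
diagonal tail, so whatever the graph it has an orthonormal eigenbasis with eigenvalues exactly
`lam`. Hence the limit is approximated in norm by operators with the same eigenvalue list, and only
that list matters.

Two dense enumerations of a compact `Λ` agree up to a permutation and an error below `ε`. Points
with infinitely many neighbours in `Λ` within `ε` can be matched injectively to nearby terms of the
other enumeration. The remaining points are finitely many and occur in both lists, so they are
matched to themselves. Doing this in both directions, Schröder–Bernstein gives a bijection
(`IsDenseEnumeration.exists_equiv_dist_lt`). Sending one eigenbasis to the permuted other one is
then a unitary that conjugates one operator into the other up to a small error. -/

/-! ### Matching two dense enumerations -/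

/-- Infinitely many admissible values for every index allow an injective choice. -/
theorem exists_injective_mem_of_infinite {α : Type*} (s : ℕ → Set α) (hs : ∀ i, (s i).Infinite) :
    ∃ f : ℕ → α, Function.Injective f ∧ ∀ i, f i ∈ s i := by
  classical
  choose t ht hcard using fun i => (hs i).exists_subset_card_eq (i + 1)
  -- Hall's condition: a finite index set with maximum `m` has at most `m + 1` elements, and `t m`
  -- alone has that many.
  obtain ⟨f, hf, hft⟩ := (Finset.all_card_le_biUnion_card_iff_exists_injective t).1 fun u => by
    rcases u.eq_empty_or_nonempty with rfl | hu
    · simp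
    · calc u.card ≤ (Finset.range (u.max' hu + 1)).card :=
            Finset.card_le_card fun x hx =>
              Finset.mem_range.2 (Nat.lt_succ_of_le (u.le_max' x hx))
        _ = (t (u.max' hu)).card := by rw [Finset.card_range, hcard]
        _ ≤ (u.biUnion t).card :=
            Finset.card_le_card (Finset.subset_biUnion_of_mem t (u.max'_mem hu))
  exact ⟨f, hf, fun i => ht i (hft i)⟩

/-- In a compact set, only finitely many points have a finite neighbourhood of fixed radius. -/
theorem IsCompact.finite_setOf_finite_inter_ball {X : Type*} [PseudoMetricSpace X] {K : Set X}
    (hK : IsCompact K) {ε : ℝ} (hε : 0 < ε) :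
    {x ∈ K | (K ∩ Metric.ball x ε).Finite}.Finite := by
  obtain ⟨t, -, ht, hcover⟩ := hK.finite_cover_balls (half_pos hε)
  have hpiece : ∀ c ∈ t,
      ({x ∈ K | (K ∩ Metric.ball x ε).Finite} ∩ Metric.ball c (ε / 2)).Finite := by
    intro c _
    rcases Set.eq_empty_or_nonempty
      ({x ∈ K | (K ∩ Metric.ball x ε).Finite} ∩ Metric.ball c (ε / 2)) with h | ⟨y, hy, hyc⟩
    · rw [h]
      exact Set.finite_empty
    -- Two points of a ball of radius `ε / 2` are within `ε`, so one such point `y` captures the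
    -- whole piece in its finite neighbourhood.
    · refine hy.2.subset fun x hx => ⟨hx.1.1, ?_⟩
      have h₁ : dist x c < ε / 2 := hx.2
      have h₂ : dist y c < ε / 2 := hyc
      have := dist_triangle_right x y c
      rw [Metric.mem_ball]
      linarith
  refine (ht.biUnion hpiece).subset fun x hx => ?_
  obtain ⟨c, hc, hxc⟩ := Set.mem_iUnion₂.1 (hcover hx.1)
  exact Set.mem_iUnion₂.2 ⟨c, hc, hx, hxc⟩

/-- Finitely many values form a closed set, and density within the open ball would then force `Λ ∩
ball` to lie inside it. -/
theorem IsDenseEnumeration.infinite_setOf_mem_ball {Λ : Set ℝ} {mu : ℕ → ℝ}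
    (h : IsDenseEnumeration Λ mu) {x ε : ℝ}
    (hx : (Λ ∩ Metric.ball x ε).Infinite) : {j | mu j ∈ Metric.ball x ε}.Infinite := by
  intro hfin
  refine hx ((hfin.image mu).subset ?_)
  rintro y ⟨hyΛ, hy⟩
  have hcl : y ∈ closure (Metric.ball x ε ∩ Set.range mu) :=
    Metric.isOpen_ball.inter_closure ⟨hy, h.dense hyΛ⟩
  have himage : Metric.ball x ε ∩ Set.range mu = mu '' {j | mu j ∈ Metric.ball x ε} := by
    ext z
    constructor
    · rintro ⟨hz, j, rfl⟩
      exact ⟨j, hz, rfl⟩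
    · rintro ⟨j, hj, rfl⟩
      exact ⟨hj, j, rfl⟩
  rwa [himage, (hfin.image mu).isClosed.closure_eq] at hcl

theorem IsDenseEnumeration.mem_range_of_finite {Λ : Set ℝ} {mu : ℕ → ℝ}
    (h : IsDenseEnumeration Λ mu) {x ε : ℝ} (hε : 0 < ε) (hx : x ∈ Λ)
    (hfin : (Λ ∩ Metric.ball x ε).Finite) : x ∈ Set.range mu := by
  have hcl : x ∈ closure (Metric.ball x ε ∩ Set.range mu) :=
    Metric.isOpen_ball.inter_closure ⟨Metric.mem_ball_self hε, h.dense hx⟩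
  have hsub : (Metric.ball x ε ∩ Set.range mu).Finite := hfin.subset (by
    rintro _ ⟨hz, j, rfl⟩
    exact ⟨h.mem j, hz⟩)
  rw [hsub.isClosed.closure_eq] at hcl
  exact hcl.2

/-- The relation along which two dense enumerations of `Λ` are matched: points that are isolated
at scale `ε` correspond to themselves, the others to points at distance less than `ε`. -/
def MatchRel (Λ : Set ℝ) (ε x y : ℝ) : Prop :=
  ((Λ ∩ Metric.ball x ε).Finite ∧ x = y) ∨
    ((Λ ∩ Metric.ball x ε).Infinite ∧ (Λ ∩ Metric.ball y ε).Infinite ∧ dist x y < ε)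

theorem MatchRel.symm {Λ : Set ℝ} {ε x y : ℝ} (h : MatchRel Λ ε x y) : MatchRel Λ ε y x := by
  rcases h with ⟨h, rfl⟩ | ⟨h₁, h₂, h⟩
  · exact Or.inl ⟨h, rfl⟩
  · exact Or.inr ⟨h₂, h₁, by rwa [dist_comm]⟩

theorem MatchRel.dist_lt {Λ : Set ℝ} {ε x y : ℝ} (hε : 0 < ε) (h : MatchRel Λ ε x y) :
    dist x y < ε := by
  rcases h with ⟨-, rfl⟩ | ⟨-, -, h⟩
  · simpa using hε
  · exact h

/-- Compactness leaves only finitely many bad indices, so discarding them keeps every candidate set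
infinite. Good points then go to good points and bad to bad, so the two injective choices cannot
collide. -/
theorem IsDenseEnumeration.exists_injective_matchRel {Λ : Set ℝ} (hΛ : IsCompact Λ)
    {lam mu : ℕ → ℝ} (hlam : IsDenseEnumeration Λ lam) (hmu : IsDenseEnumeration Λ mu)
    {ε : ℝ} (hε : 0 < ε) :
    ∃ f : ℕ → ℕ, Function.Injective f ∧ ∀ i, MatchRel Λ ε (lam i) (mu (f i)) := by
  classical
  let good : ℝ → Prop := fun x => (Λ ∩ Metric.ball x ε).Infinite
  have hbad : {j | ¬ good (mu j)}.Finite :=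
    ((hΛ.finite_setOf_finite_inter_ball hε).preimage hmu.injective.injOn).subset
      fun j hj => ⟨hmu.mem j, Set.not_infinite.1 hj⟩
  let s : ℕ → Set ℕ := fun i =>
    if good (lam i) then {j | mu j ∈ Metric.ball (lam i) ε} \ {j | ¬ good (mu j)} else Set.univ
  obtain ⟨f, hf, hfs⟩ := exists_injective_mem_of_infinite s fun i => by
    by_cases hi : good (lam i)
    · simp only [s, if_pos hi]
      exact (hmu.infinite_setOf_mem_ball hi).sdiff hbad
    · simp only [s, if_neg hi]
      exact Set.infinite_univ
  have hex : ∀ i, ¬ good (lam i) → ∃ j, mu j = lam i := fun i hi =>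
    hmu.mem_range_of_finite hε (hlam.mem i) (Set.not_infinite.1 hi)
  choose! g hg using hex
  have hfgood : ∀ i, good (lam i) → mu (f i) ∈ Metric.ball (lam i) ε ∧ good (mu (f i)) := by
    intro i hi
    have := hfs i
    simp only [s, if_pos hi] at this
    exact ⟨this.1, not_not.1 this.2⟩
  refine ⟨fun i => if good (lam i) then f i else g i, ?_, fun i => ?_⟩
  · intro i j hij
    by_cases hi : good (lam i) <;> by_cases hj : good (lam j) <;> simp only [hi, hj, if_true,
      if_false] at hij
    · exact hf hij
    · exact absurd (hg j hj ▸ hij ▸ (hfgood i hi).2) hj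
    · exact absurd (hg i hi ▸ hij ▸ (hfgood j hj).2) hi
    · exact hlam.injective (by rw [← hg i hi, ← hg j hj, hij])
  · by_cases hi : good (lam i)
    · simp only [hi, if_true]
      exact Or.inr ⟨hi, (hfgood i hi).2, by
        simpa [dist_comm] using (hfgood i hi).1⟩
    · simp only [hi, if_false]
      exact Or.inl ⟨Set.not_infinite.1 hi, (hg i hi).symm⟩

/-- Two dense enumerations of a compact set agree up to a permutation and a uniformly small
error. -/
theorem IsDenseEnumeration.exists_equiv_dist_lt {Λ : Set ℝ} (hΛ : IsCompact Λ)
    {lam mu : ℕ → ℝ} (hlam : IsDenseEnumeration Λ lam) (hmu : IsDenseEnumeration Λ mu)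
    {ε : ℝ} (hε : 0 < ε) :
    ∃ σ : ℕ ≃ ℕ, ∀ i, dist (lam i) (mu (σ i)) < ε := by
  obtain ⟨f, hf, hfR⟩ := hlam.exists_injective_matchRel hΛ hmu hε
  obtain ⟨g, hg, hgR⟩ := hmu.exists_injective_matchRel hΛ hlam hε
  -- Every pair of the bijection comes from `f` or from `g` reversed, which is why `MatchRel` has to
  -- be symmetric.
  obtain ⟨h, hbij, hh⟩ := Function.Embedding.schroeder_bernstein_of_rel hf hg
    (fun i j => MatchRel Λ ε (lam i) (mu j)) hfR fun j => (hgR j).symm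
  exact ⟨Equiv.ofBijective h hbij, fun i => (hh i).dist_lt hε⟩

/-! ### Operators that are diagonal in a Hilbert basis -/

section Diagonal

variable {𝕜 H H' : Type*} [RCLike 𝕜]
  [NormedAddCommGroup H] [InnerProductSpace 𝕜 H]
  [NormedAddCommGroup H'] [InnerProductSpace 𝕜 H']

theorem EllTwo.norm_le_mul_of_forall_norm_le {f g : EllTwo 𝕜} {C : ℝ} (hC : 0 ≤ C)
    (h : ∀ i, ‖f i‖ ≤ C * ‖g i‖) : ‖f‖ ≤ C * ‖g‖ := by
  have := lp.norm_mono (x := f) (y := (C : 𝕜) • g) two_ne_zero fun i => by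
    simpa [norm_smul, abs_of_nonneg hC] using h i
  simpa [norm_smul, abs_of_nonneg hC] using this

/-- Continuity lets `X` and then the `i`-th coordinate functional pass through the Hilbert expansion
of `x`. -/
theorem HilbertBasis.repr_map_of_eigenvectors (b : HilbertBasis ℕ 𝕜 H) (X : H →L[𝕜] H)
    (d : ℕ → 𝕜) (hX : ∀ i, X (b i) = d i • b i) (x : H) (i : ℕ) :
    b.repr (X x) i = d i * b.repr x i := by
  classical
  have h₁ := ((b.hasSum_repr x).mapL X).mapL (innerSL 𝕜 (b i))
  have h₂ : HasSum (fun j => innerSL 𝕜 (b i) (X (b.repr x j • b j))) (d i * b.repr x i) := by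
    convert hasSum_ite_eq i (d i * b.repr x i) using 2 with j
    rw [map_smul, hX, innerSL_apply_apply, inner_smul_right, inner_smul_right,
      orthonormal_iff_ite.1 b.orthonormal]
    by_cases hij : j = i
    · subst hij; simp [mul_comm]
    · simp [hij, Ne.symm hij]
  rw [b.repr_apply_apply]
  simpa using h₁.unique h₂

theorem HilbertBasis.opNorm_le_of_eigenvectors (b : HilbertBasis ℕ 𝕜 H) (X : H →L[𝕜] H)
    (d : ℕ → 𝕜) (hX : ∀ i, X (b i) = d i • b i) {C : ℝ} (hC : 0 ≤ C) (hd : ∀ i, ‖d i‖ ≤ C) :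
    ‖X‖ ≤ C := by
  refine X.opNorm_le_bound hC fun x => ?_
  rw [← b.repr.norm_map (X x), ← b.repr.norm_map x]
  refine EllTwo.norm_le_mul_of_forall_norm_le hC fun i => ?_
  rw [b.repr_map_of_eigenvectors X d hX, norm_mul]
  exact mul_le_mul_of_nonneg_right (hd i) (norm_nonneg _)

/-- A Hilbert basis with permuted indices. -/
theorem HilbertBasis.exists_permute [CompleteSpace H] (b : HilbertBasis ℕ 𝕜 H) (σ : ℕ ≃ ℕ) :
    ∃ b' : HilbertBasis ℕ 𝕜 H, ∀ i, b' i = b (σ i) := by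
  have horth : Orthonormal 𝕜 (fun i => b (σ i)) := b.orthonormal.comp σ σ.injective
  have hrange : Set.range (fun i => b (σ i)) = Set.range b := σ.surjective.range_comp b
  refine ⟨HilbertBasis.mk horth ?_, fun i => ?_⟩
  · rw [hrange, b.dense_span]
  · rw [HilbertBasis.coe_mk]

/-- Operators that are diagonal in Hilbert bases, with uniformly close eigenvalues, are unitarily
equivalent up to a small error. -/
theorem HilbertBasis.exists_unitary_norm_sub_le (b : HilbertBasis ℕ 𝕜 H)
    (b' : HilbertBasis ℕ 𝕜 H') (S : H →L[𝕜] H) (T : H' →L[𝕜] H') (s t : ℕ → ℝ)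
    (hS : ∀ i, S (b i) = (s i : 𝕜) • b i) (hT : ∀ i, T (b' i) = (t i : 𝕜) • b' i)
    {ε : ℝ} (hε : 0 ≤ ε) (hst : ∀ i, dist (s i) (t i) ≤ ε) :
    ∃ U : H ≃ₗᵢ[𝕜] H', ‖(U.symm : H' →L[𝕜] H) ∘L T ∘L (U : H →L[𝕜] H') - S‖ ≤ ε := by
  classical
  let U : H ≃ₗᵢ[𝕜] H' := b.repr.trans b'.repr.symm
  have hU : ∀ i, U (b i) = b' i := fun i => by
    simp only [U, LinearIsometryEquiv.trans_apply, b.repr_self, b'.repr_symm_single]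
  have hU' : ∀ i, U.symm (b' i) = b i := fun i => by rw [← hU, U.symm_apply_apply]
  refine ⟨U, b.opNorm_le_of_eigenvectors _ (fun i => ((t i - s i : ℝ) : 𝕜)) (fun i => ?_) hε
    fun i => ?_⟩
  · have : U.symm (T (U (b i))) = (t i : 𝕜) • b i := by
      rw [hU, hT, map_smul, hU']
    simp only [_root_.sub_apply, ContinuousLinearMap.comp_apply]
    rw [hS, RCLike.ofReal_sub, sub_smul, ← this]
    rfl
  · rw [RCLike.norm_ofReal, abs_sub_comm]
    exact hst i

/-- `T` is a norm limit of operators with an eigenbasis whose eigenvalues are `lam`. -/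
def IsLimitOfDiagonal (T : H →L[𝕜] H) (lam : ℕ → ℝ) : Prop :=
  ∀ ε > 0, ∃ T' : H →L[𝕜] H, ‖T' - T‖ < ε ∧
    ∃ b : HilbertBasis ℕ 𝕜 H, ∀ i, T' (b i) = (lam i : 𝕜) • b i

theorem LinearIsometryEquiv.norm_conj_le (U : H ≃ₗᵢ[𝕜] H') (X : H' →L[𝕜] H') :
    ‖(U.symm : H' →L[𝕜] H) ∘L X ∘L (U : H →L[𝕜] H')‖ ≤ ‖X‖ := by
  refine ContinuousLinearMap.opNorm_le_bound _ (norm_nonneg _) fun x => ?_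
  calc ‖U.symm (X (U x))‖ = ‖X (U x)‖ := U.symm.norm_map _
    _ ≤ ‖X‖ * ‖U x‖ := X.le_opNorm _
    _ = ‖X‖ * ‖x‖ := by rw [U.norm_map]

theorem ApproxUnitarilyEquiv.of_forall_exists {S : H →L[𝕜] H} {T : H' →L[𝕜] H'}
    (h : ∀ ε > 0, ∃ U : H ≃ₗᵢ[𝕜] H', ‖(U.symm : H' →L[𝕜] H) ∘L T ∘L (U : H →L[𝕜] H') - S‖ < ε) :
    ApproxUnitarilyEquiv S T := by
  choose U hU using fun n : ℕ => h (1 / ((n : ℝ) + 1)) Nat.one_div_pos_of_nat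
  refine ⟨U, tendsto_iff_norm_sub_tendsto_zero.2 ?_⟩
  exact squeeze_zero (fun _ => norm_nonneg _) (fun n => (hU n).le)
    tendsto_one_div_add_atTop_nhds_zero_nat

theorem IsLimitOfDiagonal.approxUnitarilyEquiv [CompleteSpace H'] {Λ : Set ℝ} (hΛ : IsCompact Λ)
    {lam mu : ℕ → ℝ} (hlam : IsDenseEnumeration Λ lam) (hmu : IsDenseEnumeration Λ mu)
    {S : H →L[𝕜] H} {T : H' →L[𝕜] H'}
    (hS : IsLimitOfDiagonal S lam) (hT : IsLimitOfDiagonal T mu) : ApproxUnitarilyEquiv S T := by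
  refine ApproxUnitarilyEquiv.of_forall_exists fun ε hε => ?_
  have hε' : 0 < ε / 3 := by positivity
  obtain ⟨S', hS', b, hb⟩ := hS _ hε'
  obtain ⟨T', hT', c, hc⟩ := hT _ hε'
  obtain ⟨σ, hσ⟩ := hlam.exists_equiv_dist_lt hΛ hmu hε'
  obtain ⟨c', hc'⟩ := c.exists_permute σ
  obtain ⟨U, hU⟩ := b.exists_unitary_norm_sub_le c' S' T' lam (fun i => mu (σ i)) hb
    (fun i => by rw [hc', hc]) hε'.le fun i => (hσ i).le
  refine ⟨U, ?_⟩
  -- Three errors of at most `ε / 3`: replacing `T` by `T'` (conjugation does not increase the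
  -- norm), matching eigenvalues, and replacing `S'` by `S`.
  have hdecomp : (U.symm : H' →L[𝕜] H) ∘L T ∘L (U : H →L[𝕜] H') - S =
      (U.symm : H' →L[𝕜] H) ∘L (T - T') ∘L (U : H →L[𝕜] H') +
        ((U.symm : H' →L[𝕜] H) ∘L T' ∘L (U : H →L[𝕜] H') - S') + (S' - S) := by
    simp only [ContinuousLinearMap.sub_comp, ContinuousLinearMap.comp_sub]
    abel
  have hTT' := (U.norm_conj_le (T - T')).trans_lt (norm_sub_rev T T' ▸ hT')
  rw [hdecomp]
  refine (norm_add₃_le).trans_lt ?_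
  linarith

end Diagonal

/-! ### Diagonal operators on `ℓ²` -/

section EllTwo

variable {𝕜 : Type*} [RCLike 𝕜]

theorem exists_hilbertBasis_eq_single :
    ∃ b : HilbertBasis ℕ 𝕜 (EllTwo 𝕜), ∀ i, b i = lp.single 2 i (1 : 𝕜) :=
  ⟨HilbertBasis.ofRepr (LinearIsometryEquiv.refl 𝕜 (EllTwo 𝕜)), fun i => by
    rw [← HilbertBasis.repr_symm_single]; rfl⟩

theorem exists_standardMatrix_eq_diagonal (d : ℕ → 𝕜) {C : ℝ} (hd : ∀ i, ‖d i‖ ≤ C) :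
    ∃ D : EllTwo 𝕜 →L[𝕜] EllTwo 𝕜, standardMatrix D = Matrix.diagonal d := by
  have hC : 0 ≤ C := (norm_nonneg _).trans (hd 0)
  have hmul : ∀ (f : EllTwo 𝕜) i, ‖d i * f i‖ ≤ C * ‖f i‖ := fun f i => by
    rw [norm_mul]
    exact mul_le_mul_of_nonneg_right (hd i) (norm_nonneg _)
  have hmem : ∀ f : EllTwo 𝕜, Memℓp (fun i => d i * f i) 2 := fun f =>
    ((lp.memℓp f).norm.const_mul C).mono (hmul f)
  let L : EllTwo 𝕜 →ₗ[𝕜] EllTwo 𝕜 :=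
    { toFun := fun f => ⟨fun i => d i * f i, hmem f⟩
      map_add' := fun f g => by
        ext i
        exact mul_add (d i) (f i) (g i)
      map_smul' := fun c f => by
        ext i
        exact mul_left_comm (d i) c (f i) }
  refine ⟨L.mkContinuous C fun f => EllTwo.norm_le_mul_of_forall_norm_le hC (hmul f), ?_⟩
  ext i j
  change d i * (lp.single 2 j (1 : 𝕜) : EllTwo 𝕜) i = _
  rw [lp.single_apply, Matrix.diagonal_apply, Pi.single_apply]
  simp

theorem isLimitOfDiagonal_of_standardMatrix_eq {D : EllTwo 𝕜 →L[𝕜] EllTwo 𝕜} {mu : ℕ → ℝ}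
    (hD : standardMatrix D = Matrix.diagonal (fun i => (mu i : 𝕜))) : IsLimitOfDiagonal D mu := by
  obtain ⟨b, hb⟩ := exists_hilbertBasis_eq_single (𝕜 := 𝕜)
  refine fun ε hε => ⟨D, by simpa using hε, b, fun j => ?_⟩
  rw [hb]
  ext i
  have := congrFun (congrFun hD i) j
  simp only [standardMatrix, Matrix.of_apply, Matrix.diagonal_apply] at this
  rw [this, lp.coeFn_smul, Pi.smul_apply, lp.single_apply, Pi.single_apply]
  by_cases hij : i = j <;> simp [hij]

/-! ### Eigenbases of finite perturbations of a diagonal operator -/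

/-- A real vector of length `n`, as the finitely supported sequence in `ℓ²`. -/
noncomputable def finEmbed (𝕜 : Type*) [RCLike 𝕜] {n : ℕ} (u : Fin n → ℝ) : EllTwo 𝕜 :=
  ∑ j : Fin n, (u j : 𝕜) • lp.single 2 (j : ℕ) (1 : 𝕜)

theorem finEmbed_apply {n : ℕ} (u : Fin n → ℝ) (k : ℕ) :
    finEmbed 𝕜 u k = if h : k < n then (u ⟨k, h⟩ : 𝕜) else 0 := by
  rw [finEmbed, lp.coeFn_sum, Finset.sum_apply]
  simp only [lp.coeFn_smul, Pi.smul_apply, lp.single_apply, Pi.single_apply, smul_eq_mul]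
  split_ifs with h
  · rw [Finset.sum_eq_single ⟨k, h⟩] <;> aesop
  · exact Finset.sum_eq_zero fun j _ => by
      have : k ≠ j := fun hk => h (hk ▸ j.2)
      simp [this]

theorem inner_finEmbed_left {n : ℕ} (u : Fin n → ℝ) (x : EllTwo 𝕜) :
    inner 𝕜 (finEmbed 𝕜 u) x = ∑ j : Fin n, (u j : 𝕜) * x j := by
  rw [finEmbed, sum_inner]
  refine Finset.sum_congr rfl fun j _ => ?_
  rw [inner_smul_left, lp.inner_single_left]
  simp

/-- An orthonormal basis of `ℝⁿ`, completed by the standard basis vectors `eₙ, eₙ₊₁, …`. -/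
theorem exists_hilbertBasis_extend {n : ℕ}
    (u : OrthonormalBasis (Fin n) ℝ (EuclideanSpace ℝ (Fin n))) :
    ∃ b : HilbertBasis ℕ 𝕜 (EllTwo 𝕜), ∀ i, b i =
      if h : i < n then finEmbed 𝕜 (u ⟨i, h⟩) else lp.single 2 i (1 : 𝕜) := by
  classical
  let v : ℕ → EllTwo 𝕜 := fun i =>
    if h : i < n then finEmbed 𝕜 (u ⟨i, h⟩) else lp.single 2 i (1 : 𝕜)
  have hlt : ∀ {i} (h : i < n), v i = finEmbed 𝕜 (u ⟨i, h⟩) := fun h => dif_pos h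
  have hge : ∀ {i}, ¬ i < n → v i = lp.single 2 i (1 : 𝕜) := fun h => dif_neg h
  have horth : Orthonormal 𝕜 v := by
    rw [orthonormal_iff_ite]
    intro i j
    by_cases hi : i < n
    · rw [hlt hi, inner_finEmbed_left]
      by_cases hj : j < n
      · have := orthonormal_iff_ite.1 u.orthonormal ⟨i, hi⟩ ⟨j, hj⟩
        rw [PiLp.inner_apply] at this
        rw [hlt hj]
        have hcast := congrArg (fun r : ℝ => (r : 𝕜)) this
        simp only [RCLike.ofReal_sum, Fin.mk.injEq] at hcast
        rw [show (if i = j then (1 : 𝕜) else 0) = (((if i = j then 1 else 0 : ℝ)) : 𝕜) by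
          split_ifs <;> simp, ← hcast]
        refine Finset.sum_congr rfl fun k _ => ?_
        rw [finEmbed_apply, dif_pos k.2]
        simp [mul_comm]
      · rw [hge hj, if_neg (fun h : i = j => hj (h ▸ hi))]
        refine Finset.sum_eq_zero fun k _ => ?_
        have : (k : ℕ) ≠ j := fun h => hj (h ▸ k.2)
        rw [lp.single_apply_ne _ _ _ this, mul_zero]
    · rw [hge hi, lp.inner_single_left]
      by_cases hj : j < n
      · rw [hlt hj, finEmbed_apply, dif_neg hi, if_neg (fun h : i = j => hi (h ▸ hj))]
        simp
      · rw [hge hj, lp.single_apply, Pi.single_apply]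
        simp
  have hbot : (Submodule.span 𝕜 (Set.range v))ᗮ = ⊥ := by
    refine (Submodule.eq_bot_iff _).2 fun x hx => ?_
    have hxv : ∀ i, inner 𝕜 (v i) x = 0 := fun i =>
      Submodule.inner_right_of_mem_orthogonal (Submodule.subset_span (Set.mem_range_self i)) hx
    ext k
    by_cases hk : k < n
    -- Expanding the `k`-th standard vector in `u` writes `x k` as a combination of the vanishing
    -- inner products.
    · have hsum : ∀ j : Fin n, ∑ i, (u.repr (EuclideanSpace.single ⟨k, hk⟩ 1) i : ℝ) * u i j =
          if j = ⟨k, hk⟩ then 1 else 0 := fun j => by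
        have := congrArg (fun w : EuclideanSpace ℝ (Fin n) => w j)
          (u.sum_repr (EuclideanSpace.single ⟨k, hk⟩ 1))
        simpa [Pi.single_apply] using this
      calc x k = ∑ j : Fin n, ((if j = ⟨k, hk⟩ then 1 else 0 : ℝ) : 𝕜) * x j := by
            rw [Finset.sum_eq_single ⟨k, hk⟩] <;> simp +contextual
        _ = ∑ i, (u.repr (EuclideanSpace.single ⟨k, hk⟩ 1) i : 𝕜) *
              ∑ j : Fin n, (u i j : 𝕜) * x j := by
            simp only [← hsum, RCLike.ofReal_sum, RCLike.ofReal_mul, Finset.sum_mul,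
              Finset.mul_sum, mul_assoc]
            exact Finset.sum_comm
        _ = 0 := Finset.sum_eq_zero fun i _ => by
            have := hxv i
            rw [hlt i.2, inner_finEmbed_left] at this
            rw [this, mul_zero]
    · have := hxv k
      rw [hge hk, lp.inner_single_left] at this
      simpa using this
  exact ⟨HilbertBasis.mkOfOrthogonalEqBot horth hbot, fun i => by
    rw [HilbertBasis.coe_mkOfOrthogonalEqBot]⟩

/-- A symmetric `n × n` matrix with `n` distinct prescribed eigenvalues has an orthonormal
eigenbasis, in the prescribed order. -/
theorem Matrix.IsSymm.exists_orthonormalBasis_of_spectrum_eq {n : ℕ}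
    {A : Matrix (Fin n) (Fin n) ℝ} (hA : A.IsSymm) {lam : ℕ → ℝ} (hlam : Function.Injective lam)
    (hspec : spectrum ℝ A = lam '' Set.Iio n) :
    ∃ u : OrthonormalBasis (Fin n) ℝ (EuclideanSpace ℝ (Fin n)),
      ∀ i : Fin n, A.mulVec (u i) = lam i • (u i : Fin n → ℝ) := by
  have hH : A.IsHermitian := by
    rw [Matrix.IsHermitian, Matrix.conjTranspose_eq_transpose_of_trivial]
    exact hA
  have hex : ∀ i : Fin n, ∃ j, hH.eigenvalues j = lam i := fun i => by
    have : lam i ∈ spectrum ℝ A := hspec ▸ ⟨i, i.2, rfl⟩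
    rwa [hH.spectrum_real_eq_range_eigenvalues] at this
  choose σ hσ using hex
  -- The `n` prescribed values are distinct, so they exhaust the `n` eigenvalues and `σ` merely
  -- reorders them.
  have hinj : Function.Injective σ := fun i j hij =>
    Fin.ext (hlam (by rw [← hσ i, ← hσ j, hij]))
  let e : Fin n ≃ Fin n := Equiv.ofBijective σ (Finite.injective_iff_bijective.1 hinj)
  refine ⟨hH.eigenvectorBasis.reindex e.symm, fun i => ?_⟩
  rw [OrthonormalBasis.reindex_apply, Equiv.symm_symm, hH.mulVec_eigenvectorBasis]
  exact congrArg (· • _) (hσ i)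

theorem exists_eigenbasis_of_standardMatrix_eq {n : ℕ} {A : Matrix (Fin n) (Fin n) ℝ}
    (hA : A.IsSymm) {lam : ℕ → ℝ} (hlam : Function.Injective lam)
    (hspec : spectrum ℝ A = lam '' Set.Iio n) {T : EllTwo 𝕜 →L[𝕜] EllTwo 𝕜}
    (hT : standardMatrix T = (extendDiag A lam).map (fun x : ℝ => (x : 𝕜))) :
    ∃ b : HilbertBasis ℕ 𝕜 (EllTwo 𝕜), ∀ i, T (b i) = (lam i : 𝕜) • b i := by
  obtain ⟨u, hu⟩ := hA.exists_orthonormalBasis_of_spectrum_eq hlam hspec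
  obtain ⟨b, hb⟩ := exists_hilbertBasis_extend (𝕜 := 𝕜) u
  have hentry : ∀ k j, T (lp.single 2 j (1 : 𝕜)) k = (extendDiag A lam k j : 𝕜) := fun k j =>
    congrFun (congrFun hT k) j
  refine ⟨b, fun i => ?_⟩
  rw [hb]
  ext k
  rw [lp.coeFn_smul, Pi.smul_apply, smul_eq_mul]
  split_ifs with hi
  · have hlin : T (finEmbed 𝕜 (u ⟨i, hi⟩)) k =
        ∑ j : Fin n, (u ⟨i, hi⟩ j : 𝕜) * (extendDiag A lam k j : 𝕜) := by
      simp only [← hentry]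
      rw [finEmbed, map_sum, lp.coeFn_sum, Finset.sum_apply]
      refine Finset.sum_congr rfl fun j _ => ?_
      rw [map_smul, lp.coeFn_smul, Pi.smul_apply, smul_eq_mul]
    rw [hlin, finEmbed_apply]
    split_ifs with hk
    · have := congrFun (hu ⟨i, hi⟩) ⟨k, hk⟩
      rw [Pi.smul_apply, smul_eq_mul, Matrix.mulVec, dotProduct] at this
      rw [← RCLike.ofReal_mul, ← this, RCLike.ofReal_sum]
      refine Finset.sum_congr rfl fun j _ => ?_
      rw [extendDiag, Matrix.of_apply, dif_pos ⟨hk, j.2⟩, RCLike.ofReal_mul, mul_comm]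
    · rw [mul_zero]
      refine Finset.sum_eq_zero fun j _ => ?_
      have : k ≠ j := fun h => hk (h ▸ j.2)
      rw [extendDiag, Matrix.of_apply, dif_neg (fun h => hk h.1), if_neg this]
      simp
  · rw [hentry, lp.single_apply, Pi.single_apply, extendDiag, Matrix.of_apply,
      dif_neg (fun h => hi h.2)]
    by_cases hki : k = i <;> simp [hki]

theorem IsConstructedSolution.exists_isLimitOfDiagonal {V : Type*} {G : SimpleGraph V}
    {Λ : Set ℝ} {T : EllTwo 𝕜 →L[𝕜] EllTwo 𝕜} (h : IsConstructedSolution G Λ T) :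
    ∃ lam : ℕ → ℝ, IsDenseEnumeration Λ lam ∧ IsLimitOfDiagonal T lam := by
  obtain ⟨e, lam, A, Tₙ, hlam, hA, hTₙ, hlim⟩ := h
  refine ⟨lam, hlam, fun ε hε => ?_⟩
  obtain ⟨n, hn⟩ := ((Metric.tendsto_nhds.1 hlim) ε hε).exists
  exact ⟨Tₙ n, by rwa [← dist_eq_norm], exists_eigenbasis_of_standardMatrix_eq (hA.symm n)
    hlam.injective (hA.spectrum_eq n) (hTₙ n)⟩

end EllTwo

theorem mainTheorem4 {𝕜 : Type*} [RCLike 𝕜]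
    {V₁ V₂ : Type*} [Countable V₁] [Infinite V₁] [Countable V₂] [Infinite V₂]
    (G₁ : SimpleGraph V₁) (G₂ : SimpleGraph V₂)
    (Λ : Set ℝ) (hΛ : IsCompact Λ) (hΛ_inf : Λ.Infinite)
    (S T : EllTwo 𝕜 →L[𝕜] EllTwo 𝕜)
    (hS : IsConstructedSolution G₁ Λ S) (hT : IsConstructedSolution G₂ Λ T) :
    ApproxUnitarilyEquiv S T ∧
      ∀ mu : ℕ → ℝ, IsDenseEnumeration Λ mu →
        ∃ D : EllTwo 𝕜 →L[𝕜] EllTwo 𝕜,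
          standardMatrix D = Matrix.diagonal (fun i => (mu i : 𝕜)) ∧
            ApproxUnitarilyEquiv T D := by
  obtain ⟨lam, hlam, hSlam⟩ := hS.exists_isLimitOfDiagonal
  obtain ⟨lam', hlam', hTlam'⟩ := hT.exists_isLimitOfDiagonal
  refine ⟨hSlam.approxUnitarilyEquiv hΛ hlam hlam' hTlam', fun mu hmu => ?_⟩
  obtain ⟨C, hC⟩ := hΛ.isBounded.exists_norm_le
  obtain ⟨D, hD⟩ := exists_standardMatrix_eq_diagonal (fun i => (mu i : 𝕜)) (C := C) fun i => by
    rw [RCLike.norm_ofReal]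
    exact hC _ (hmu.mem i)
  exact ⟨D, hD, hTlam'.approxUnitarilyEquiv hΛ hlam' hmu (isLimitOfDiagonal_of_standardMatrix_eq hD)⟩
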